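/- Let $D_n$ be the Coxeter group with generators $s_{1'},s_1,\dots,s_{n-1}$ (each an involution) in which $s_js_{j+1}$ ($1\le j\le n-2$) and $s_{1'}s_2$ have order $3$ and all other pairs of distinct generators commute, and let $\ell$ denote Coxeter length. Put $t_m=s_1s_2\cdots s_{m-1}$ for $2\le m\le n$ and $w_L=s_Ls_{L-1}\cdots s_1\,s_{1'}\,s_2s_3\cdots s_L$ for $1\le L\le n-1$. Let $\Phi:D_n\to S_n$ be the homomorphism with $\Phi(s_{1'})=\Phi(s_1)=(1\;2)$ and $\Phi(s_j)=(j\;\,j{+}1)$, where permutations are multiplied from left to right, and write $\pi'=\Phi(\pi)$. For $\sigma\in S_n$ let $\ell(\sigma)$ be the number of inversions of $\sigma$ and $\mathrm{maj}(\sigma)=\sum_{a:\,\sigma(a)>\sigma(a+1)}a$. Let $\pi^\circ=t_{k_1}^{i_{k_1}}t_{k_2}^{i_{k_2}}\cdots t_{k_m}^{i_{k_m}}$ with $2\le k_1<\cdots<k_m\le n$ and $0<i_{k_x}<k_x$ for all $x$, be elementary, that is, $\sum_{x=1}^m i_{k_x}\le k_1$. (The case $m=0$, $\pi^\circ=1$,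 is allowed.) Let $L_1,\dots,L_u$ be pairwise distinct integers with $1\le L_j\le n-1$, and let $\pi=w_{L_1}w_{L_2}\cdots w_{L_u}\cdot\pi^\circ\in D_n$. For each $j$ set $$\varrho_{L_j}(\pi')=\begin{cases}L_j & \text{if } L_j<\mathrm{maj}(\pi')\ \text{or}\ L_j\ge k_m,\\ L_j-\mathrm{maj}(\pi') & \text{if } \mathrm{maj}(\pi')\le L_j<k_1,\\ L_j-\sum_{x=q}^m i_{k_x} & \text{if } k_{q-1}\le L_j<k_q \text{ for some } 2\le q\le m,\end{cases}$$ with $\varrho_{L_j}(\pi')=L_j$ when $m=0$. Then $$\ell(\pi)=\ell(\pi')+2\sum_{j=1}^u\varrho_{L_j}(\pi').$$ -/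

import Mathlib

namespace DOGS

/-- The Coxeter matrix of type `D_n`. The node `0` is `s_{1'}` and the node `j`, for
`1 ≤ j ≤ n - 1`, is `s_j`. The bonds of order `3` are `s_j — s_{j+1}` (`1 ≤ j ≤ n - 2`) and
`s_{1'} — s_2`; in particular `s_{1'}` commutes with every `s_j`, `j ≠ 2`. -/
def matrixD (n : ℕ) : CoxeterMatrix (Fin n) where
  M := Matrix.of fun i j : Fin n ↦
    if i = j then 1
    else if (1 ≤ (i : ℕ) ∧ (i : ℕ) + 1 = j) ∨ (1 ≤ (j : ℕ) ∧ (j : ℕ) + 1 = i) then 3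
    else if ((i : ℕ) = 0 ∧ (j : ℕ) = 2) ∨ ((j : ℕ) = 0 ∧ (i : ℕ) = 2) then 3
    else 2
  isSymm := by
    ext i j
    simp only [Matrix.transpose_apply, Matrix.of_apply, eq_comm (a := j) (b := i),
      or_comm (a := 1 ≤ (j : ℕ) ∧ (j : ℕ) + 1 = i), or_comm (a := (j : ℕ) = 0 ∧ (i : ℕ) = 2)]
  diagonal := by simp
  off_diagonal := by
    intro i j h
    simp only [Matrix.of_apply, if_neg h]
    split_ifs <;> norm_num

/-- The Coxeter group `D_n`, given by its Coxeter presentation. -/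
abbrev D (n : ℕ) : Type := (matrixD n).Group

/-- The Coxeter length on `D_n`: the least number of Coxeter generators in a word for `π`. -/
noncomputable def ell {n : ℕ} (π : D n) : ℕ := (matrixD n).toCoxeterSystem.length π

/-- The Coxeter generators of `D_n`: `gen n 0 = s_{1'}` and `gen n j = s_j` for `1 ≤ j < n`
(and the junk value `1` for `n ≤ j`). -/
def gen (n j : ℕ) : D n := if h : j < n then (matrixD n).simple ⟨j, h⟩ else 1

/-- `t_m = s_1 s_2 ⋯ s_{m-1}`, for `2 ≤ m ≤ n`. -/
def t (n m : ℕ) : D n := ((List.range (m - 1)).map fun j ↦ gen n (j + 1)).prod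

/-- `w_k = (s_k s_{k-1} ⋯ s_1) s_{1'} (s_2 s_3 ⋯ s_k)`, for `1 ≤ k ≤ n - 1`. -/
def w (n k : ℕ) : D n :=
  ((List.range k).map fun j ↦ gen n (k - j)).prod * gen n 0 *
    ((List.range (k - 1)).map fun j ↦ gen n (j + 2)).prod

/-- The adjacent transposition of the (zero-based) places `a` and `a + 1`. -/
def adj (n a : ℕ) : Equiv.Perm (Fin n) :=
  if h : a + 1 < n then Equiv.swap ⟨a, Nat.lt_of_succ_lt h⟩ ⟨a + 1, h⟩ else 1

theorem adj_mul_self (n a : ℕ) : adj n a * adj n a = 1 := by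
  unfold adj
  split_ifs <;> simp

theorem adj_comm (n a b : ℕ) (h : a + 1 < b) : adj n a * adj n b = adj n b * adj n a := by
  unfold adj
  split_ifs with h1 h2
  · refine (Equiv.Perm.Disjoint.commute ?_).eq
    refine Equiv.Perm.disjoint_swap_swap ?_
    simp only [List.nodup_cons, List.mem_cons, Fin.mk.injEq, List.not_mem_nil, or_false,
      not_or, List.nodup_nil, and_true, not_false_eq_true]
    omega
  all_goals simp

theorem adj_cube (n a : ℕ) (h : a + 2 < n) : (adj n a * adj n (a + 1)) ^ 3 = 1 := by
  have h1 : a + 1 < n := by omega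
  have h3 : a + 1 + 1 < n := by omega
  unfold adj
  rw [dif_pos h1, dif_pos h3]
  have hab : (⟨a, by omega⟩ : Fin n) ≠ ⟨a + 1, h1⟩ := by simp
  have hbc : (⟨a + 1, h1⟩ : Fin n) ≠ ⟨a + 1 + 1, h3⟩ := by simp
  have hac : (⟨a, by omega⟩ : Fin n) ≠ ⟨a + 1 + 1, h3⟩ := by simp [Fin.ext_iff]; omega
  have := (Equiv.Perm.isThreeCycle_swap_mul_swap_same hab.symm hbc hac).orderOf
  rw [Equiv.swap_comm, ← this]
  exact pow_orderOf_eq_one _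

theorem pow_swap_sides {G : Type*} [Group G] {x y : G} {k : ℕ} (h : (x * y) ^ k = 1) :
    (y * x) ^ k = 1 := by
  have : y * x = x⁻¹ * (x * y) * x := by group
  rw [this]
  have := conj_pow (i := k) (a := x⁻¹) (b := x * y)
  rw [inv_inv] at this
  rw [this, h]
  simp

/-- Sending `s_{1'}` and `s_1` to the transposition `(1 2)` and `s_j` to `(j j+1)` respects the
Coxeter relations. -/
theorem isLiftable_adj (n : ℕ) :
    (matrixD n).IsLiftable fun j : Fin n ↦ MulOpposite.op (adj n ((j : ℕ) - 1)) := by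
  intro i j
  rw [← MulOpposite.op_mul, ← MulOpposite.op_pow, MulOpposite.op_eq_one_iff]
  change _ ^ (if i = j then 1
    else if (1 ≤ (i : ℕ) ∧ (i : ℕ) + 1 = j) ∨ (1 ≤ (j : ℕ) ∧ (j : ℕ) + 1 = i) then 3
    else if ((i : ℕ) = 0 ∧ (j : ℕ) = 2) ∨ ((j : ℕ) = 0 ∧ (i : ℕ) = 2) then 3
    else 2) = 1
  have hi := i.isLt
  have hj := j.isLt
  split_ifs with h1 h2 h3
  · rw [h1, pow_one, adj_mul_self]
  · rcases h2 with h | h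
    · have e : (j : ℕ) - 1 = ((i : ℕ) - 1) + 1 := by omega
      rw [e]
      exact pow_swap_sides (adj_cube n _ (by omega))
    · have e : (i : ℕ) - 1 = ((j : ℕ) - 1) + 1 := by omega
      rw [e]
      exact adj_cube n _ (by omega)
  · rcases h3 with h | h
    · have e : (j : ℕ) - 1 = ((i : ℕ) - 1) + 1 := by omega
      rw [e]
      exact pow_swap_sides (adj_cube n _ (by omega))
    · have e : (i : ℕ) - 1 = ((j : ℕ) - 1) + 1 := by omega
      rw [e]
      exact adj_cube n _ (by omega)
  · have hne : (i : ℕ) ≠ j := fun h ↦ h1 (Fin.ext h)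
    have hc : adj n ((j : ℕ) - 1) * adj n ((i : ℕ) - 1)
        = adj n ((i : ℕ) - 1) * adj n ((j : ℕ) - 1) := by
      rcases lt_trichotomy (i : ℕ) j with h | h | h
      · by_cases h0 : (j : ℕ) = 1
        · have : (i : ℕ) - 1 = (j : ℕ) - 1 := by omega
          rw [this]
        · exact (adj_comm n _ _ (by omega)).symm
      · exact absurd h hne
      · by_cases h0 : (i : ℕ) = 1
        · have : (i : ℕ) - 1 = (j : ℕ) - 1 := by omega
          rw [this]
        · exact adj_comm n _ _ (by omega)
    rw [pow_two]
    nth_rewrite 2 [hc]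
    rw [mul_assoc, ← mul_assoc (adj n ((i : ℕ) - 1)), adj_mul_self, one_mul, adj_mul_self]

/-- The homomorphism `Φ` from `D_n` to `S_n` with `Φ(s_{1'}) = Φ(s_1) = (1 2)` and
`Φ(s_j) = (j j+1)`. Permutations are multiplied from left to right, so the product on `S_n` is
opposite to the composition of maps used by `Equiv.Perm`. -/
noncomputable def Phi (n : ℕ) : D n →* (Equiv.Perm (Fin n))ᵐᵒᵖ :=
  (matrixD n).toCoxeterSystem.lift ⟨_, isLiftable_adj n⟩

/-- `π' = Φ(π)`, as a permutation of the `n` places (`a : Fin n` is the place `a + 1`). -/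
noncomputable def prime {n : ℕ} (π : D n) : Equiv.Perm (Fin n) := (Phi n π).unop

/-- The Coxeter length on `S_n`: the number of inversions. -/
def inv {n : ℕ} (σ : Equiv.Perm (Fin n)) : ℕ :=
  (Finset.univ.filter fun p : Fin n × Fin n ↦ p.1 < p.2 ∧ σ p.2 < σ p.1).card

/-- The major index: the sum of the (one-based) locations of the descents. -/
def maj {n : ℕ} (σ : Equiv.Perm (Fin n)) : ℕ :=
  ∑ a : Fin n, if h : (a : ℕ) + 1 < n then
    (if σ ⟨(a : ℕ) + 1, h⟩ < σ a then (a : ℕ) + 1 else 0) else 0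

/-- `t_{k_1}^{i_1} ⋯ t_{k_m}^{i_m}` is a standard OGS canonical form with nonzero exponents:
`2 ≤ k_1 < ⋯ < k_m ≤ n` and `0 < i_x < k_x`. -/
structure IsCanonical (n : ℕ) {m : ℕ} (k i : Fin m → ℕ) : Prop where
  strictMono : StrictMono k
  two_le : ∀ x, 2 ≤ k x
  le_n : ∀ x, k x ≤ n
  exp_pos : ∀ x, 0 < i x
  exp_lt : ∀ x, i x < k x

/-- A canonical form is elementary if `i_1 + ⋯ + i_m ≤ k_1` (for `m = 0` this is the form of the
identity, and there is no condition). -/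
structure IsElementary (n : ℕ) {m : ℕ} (k i : Fin m → ℕ) : Prop extends IsCanonical n k i where
  sum_le : ∀ hm : 0 < m, ∑ x, i x ≤ k ⟨0, hm⟩

/-- The element `t_{k_1}^{i_1} ⋯ t_{k_m}^{i_m}` of `D_n`. -/
def tProd (n : ℕ) {m : ℕ} (k i : Fin m → ℕ) : D n := (List.ofFn fun x ↦ t n (k x) ^ i x).prod

/-- The element `w_{L_1} ⋯ w_{L_u}` of `D_n`. -/
def wProd (n : ℕ) {u : ℕ} (L : Fin u → ℕ) : D n := (List.ofFn fun j ↦ w n (L j)).prod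

/-- `ϱ_L`, where `M` is the major index and `k_1 < ⋯ < k_m`:
* `L` if `L < M` or `k_m ≤ L`;
* `L - M` if `M ≤ L < k_1`;
* `L - (i_q + ⋯ + i_m)` if `k_{q-1} ≤ L < k_q` with `2 ≤ q ≤ m`; the indices `x ≥ q` are then those
  with `L < k_x`. -/
def varrho {m : ℕ} (k i : Fin m → ℕ) (M L : ℕ) : ℤ :=
  if L < M ∨ ∀ x, k x ≤ L then (L : ℤ)
  else if ∀ x, L < k x then (L : ℤ) - M
  else (L : ℤ) - ∑ x with L < k x, (i x : ℤ)

/-- The first case of `ϱ_L`, in terms of the last index. -/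
theorem varrho_of_lt_or_le {m : ℕ} {k i : Fin m → ℕ} (hk : StrictMono k) {M L : ℕ} (hm : 0 < m)
    (h : L < M ∨ k ⟨m - 1, by omega⟩ ≤ L) : varrho k i M L = L := by
  refine if_pos (h.imp_right fun h x ↦ le_trans (hk.monotone ?_) h)
  rw [Fin.le_def]
  have := x.isLt
  change (x : ℕ) ≤ m - 1
  omega

/-- The second case of `ϱ_L`, in terms of the first index. -/
theorem varrho_of_le_of_lt {m : ℕ} {k i : Fin m → ℕ} (hk : StrictMono k) {M L : ℕ} (hm : 0 < m)
    (h1 : M ≤ L) (h2 : L < k ⟨0, hm⟩) : varrho k i M L = L - M := by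
  unfold varrho
  rw [if_neg, if_pos]
  · exact fun x ↦ lt_of_lt_of_le h2 (hk.monotone (Fin.le_def.2 (Nat.zero_le _)))
  · rintro (h | h)
    · omega
    · exact absurd (h ⟨0, hm⟩) (by omega)

/-- The third case of `ϱ_L`, in terms of the index `q`; an element `k_1 ≥ M` excludes `L < M`. -/
theorem varrho_of_between {m : ℕ} {k i : Fin m → ℕ} (hk : StrictMono k) {M L : ℕ}
    (hM : ∀ x, M ≤ k x) {q : ℕ} (hq : q + 1 < m)
    (h1 : k ⟨q, by omega⟩ ≤ L) (h2 : L < k ⟨q + 1, hq⟩) :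
    varrho k i M L = L - ∑ x with ⟨q + 1, hq⟩ ≤ x, (i x : ℤ) := by
  unfold varrho
  rw [if_neg, if_neg]
  · congr 2
    ext x
    simp only [Finset.mem_filter, Finset.mem_univ, true_and]
    constructor
    · intro h
      by_contra hc
      have : x ≤ ⟨q, by omega⟩ := by
        rw [Fin.le_def] at hc ⊢
        change ¬ q + 1 ≤ (x : ℕ) at hc
        change (x : ℕ) ≤ q
        omega
      have := hk.monotone this
      omega
    · exact fun h ↦ lt_of_lt_of_le h2 (hk.monotone h)
  · exact fun h ↦ absurd (h ⟨q, by omega⟩) (by omega)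
  · rintro (h | h)
    · exact absurd (hM ⟨q, by omega⟩) (by omega)
    · exact absurd (h ⟨q + 1, hq⟩) (by omega)

end DOGS

namespace DOGS

/-- In a simply laced Coxeter system acting on `V`, let `α s` be functions on `V` that transform
like the simple roots. If `v₀` lies in the open dominant chamber then `α s (w v₀) > 0` whenever
`s` is not a left descent of `w`. -/
theorem pos_of_length_lt {B W V : Type*} [Group W] {M : CoxeterMatrix B} (cs : CoxeterSystem M W)
    (ρ : W →* Equiv.Perm V) (α : B → V → ℤ)
    (hM : ∀ s t, s ≠ t → M s t = 2 ∨ M s t = 3)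
    (h1 : ∀ s v, α s (ρ (cs.simple s) v) = -α s v)
    (h2 : ∀ s t v, M s t = 2 → α s (ρ (cs.simple t) v) = α s v)
    (h3 : ∀ s t v, M s t = 3 → α s (ρ (cs.simple t) v) = α s v + α t v)
    (v₀ : V) (h₀ : ∀ s, 0 < α s v₀) (w : W) (s : B)
    (hs : cs.length w < cs.length (cs.simple s * w)) : 0 < α s (ρ w v₀) := by
  induction hn : cs.length w using Nat.strong_induction_on generalizing w s with
  | _ N ih =>
  by_cases hw : w = 1
  · subst hw
    simpa using h₀ s
  obtain ⟨t, ht⟩ := cs.exists_leftDescent_of_ne_one hw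
  rw [cs.isLeftDescent_iff] at ht
  obtain ⟨w', rfl⟩ : ∃ w', w = cs.simple t * w' :=
    ⟨cs.simple t * w, (cs.simple_mul_simple_cancel_left t).symm⟩
  rw [cs.simple_mul_simple_cancel_left] at ht
  have hst : s ≠ t := by
    rintro rfl
    rw [cs.simple_mul_simple_cancel_left] at hs
    omega
  have hρ : ∀ (r : B) (x : W), ρ (cs.simple r * x) v₀ = ρ (cs.simple r) (ρ x v₀) := by simp
  rw [hρ]
  rcases hM s t hst with hm | hm
  · rw [h2 s t _ hm]
    refine ih _ (by omega) w' s ?_ rfl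
    have hc : cs.simple s * cs.simple t = cs.simple t * cs.simple s := by
      have := cs.simple_mul_simple_pow s t
      rw [hm, pow_two, mul_eq_one_iff_eq_inv, mul_inv_rev, cs.inv_simple, cs.inv_simple] at this
      exact this
    rw [← mul_assoc, hc, mul_assoc] at hs
    have := cs.length_simple_mul w' s
    have := cs.length_simple_mul (cs.simple s * w') t
    omega
  · rw [h3 s t _ hm]
    have ht' : 0 < α t (ρ w' v₀) := ih _ (by omega) w' t (by omega) rfl
    rcases cs.length_simple_mul w' s with h | h
    · have := ih _ (by omega) w' s (by omega) rfl
      omega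
    · obtain ⟨w'', rfl⟩ : ∃ w'', w' = cs.simple s * w'' :=
        ⟨cs.simple s * w', (cs.simple_mul_simple_cancel_left s).symm⟩
      rw [cs.simple_mul_simple_cancel_left] at h
      have hts : M t s = 3 := by rw [M.symmetric, hm]
      rw [hρ, h1, h3 t s _ hts]
      have hb : cs.simple s * (cs.simple t * (cs.simple s * w''))
          = cs.simple t * (cs.simple s * (cs.simple t * w'')) := by
        have := cs.simple_mul_simple_pow s t
        rw [hm, pow_succ, pow_two, mul_eq_one_iff_eq_inv, mul_inv_rev, cs.inv_simple,
          cs.inv_simple, mul_assoc] at this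
        have h' : cs.simple s * (cs.simple t * cs.simple s)
            = cs.simple t * (cs.simple s * cs.simple t) := by
          rw [← this, cs.simple_mul_simple_cancel_left]
        simpa only [mul_assoc] using congrArg (· * w'') h'
      rw [hb] at hs
      have := ih _ (by omega) w'' t ?_ rfl
      · omega
      · have := cs.length_simple_mul w'' t
        have := cs.length_simple_mul (cs.simple t * w'') s
        have := cs.length_simple_mul (cs.simple s * (cs.simple t * w'')) t
        omega

/-- The action of the generator `j` of `D_n` on the places of a sequence of integers: for `1 ≤ j`
the (zero-based) places `j - 1` and `j` are swapped, for `j = 0` the places `0` and `1` are swapped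
and both signs are changed. -/
def placeMap (j : ℕ) (f : ℕ → ℤ) (a : ℕ) : ℤ :=
  if j = 0 then (if a = 0 then -f 1 else if a = 1 then -f 0 else f a)
  else if a + 1 = j then f j else if a = j then f (j - 1) else f a

theorem placeMap_involutive (j : ℕ) : Function.Involutive (placeMap j) := by
  intro f
  funext a
  unfold placeMap
  grind

/-- The simple root of `D_n` that belongs to the generator `j`, as a linear form. -/
def root (j : ℕ) (f : ℕ → ℤ) : ℤ := if j = 0 then f 0 + f 1 else f j - f (j - 1)

theorem placeMap_braid_succ {j : ℕ} (hj : 1 ≤ j) (f : ℕ → ℤ) :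
    placeMap j (placeMap (j + 1) (placeMap j f))
      = placeMap (j + 1) (placeMap j (placeMap (j + 1) f)) := by
  funext a
  unfold placeMap
  grind

theorem placeMap_braid_zero (f : ℕ → ℤ) :
    placeMap 0 (placeMap 2 (placeMap 0 f)) = placeMap 2 (placeMap 0 (placeMap 2 f)) := by
  funext a
  unfold placeMap
  grind

theorem placeMap_comm {j l : ℕ} (hl : ¬(1 ≤ j ∧ j + 1 = l)) (hl' : ¬(1 ≤ l ∧ l + 1 = j))
    (h0 : ¬(j = 0 ∧ l = 2)) (h0' : ¬(l = 0 ∧ j = 2)) (f : ℕ → ℤ) :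
    placeMap j (placeMap l f) = placeMap l (placeMap j f) := by
  funext a
  unfold placeMap
  grind

/-- `placeMap j` as a permutation. -/
def placePerm (j : ℕ) : Equiv.Perm (ℕ → ℤ) := (placeMap_involutive j).toPerm

theorem mul_pow_three_of_braid {G : Type*} [Group G] {x y : G} (hx : x * x = 1) (hy : y * y = 1)
    (h : x * y * x = y * x * y) : (x * y) ^ 3 = 1 := by
  calc (x * y) ^ 3 = (x * y * x) * (y * x * y) := by simp only [pow_succ, pow_zero]; group
    _ = (x * y * x) * (x * y * x) := by rw [h]
    _ = x * y * (x * x) * y * x := by group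
    _ = x * (y * y) * x := by rw [hx]; group
    _ = 1 := by rw [hy, mul_one, hx]

theorem isLiftable_placePerm (n : ℕ) :
    (matrixD n).IsLiftable fun j : Fin n ↦ placePerm j := by
  have hsq : ∀ j, placePerm j * placePerm j = 1 := fun j ↦ Equiv.ext (placeMap_involutive j)
  intro i j
  change _ ^ (if i = j then 1
    else if (1 ≤ (i : ℕ) ∧ (i : ℕ) + 1 = j) ∨ (1 ≤ (j : ℕ) ∧ (j : ℕ) + 1 = i) then 3
    else if ((i : ℕ) = 0 ∧ (j : ℕ) = 2) ∨ ((j : ℕ) = 0 ∧ (i : ℕ) = 2) then 3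
    else 2) = 1
  split_ifs with h1 h2 h3
  · rw [h1, pow_one, hsq]
  · refine mul_pow_three_of_braid (hsq _) (hsq _) (Equiv.ext fun f ↦ ?_)
    change placeMap i (placeMap j (placeMap i f)) = placeMap j (placeMap i (placeMap j f))
    rcases h2 with ⟨h, e⟩ | ⟨h, e⟩
    · rw [← e]
      exact placeMap_braid_succ h f
    · rw [← e]
      exact (placeMap_braid_succ h f).symm
  · refine mul_pow_three_of_braid (hsq _) (hsq _) (Equiv.ext fun f ↦ ?_)
    change placeMap i (placeMap j (placeMap i f)) = placeMap j (placeMap i (placeMap j f))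
    rcases h3 with ⟨h, e⟩ | ⟨h, e⟩
    · rw [h, e]
      exact placeMap_braid_zero f
    · rw [h, e]
      exact (placeMap_braid_zero f).symm
  · have hc : placePerm i * placePerm j = placePerm j * placePerm i :=
      Equiv.ext fun f ↦ placeMap_comm (by tauto) (by tauto) (by tauto) (by tauto) f
    rw [pow_two]
    nth_rewrite 2 [hc]
    rw [mul_assoc, ← mul_assoc (placePerm j), hsq, one_mul, hsq]

/-- The action of `D_n` on sequences of integers by signed permutations of the places. -/
noncomputable def act (n : ℕ) : D n →* Equiv.Perm (ℕ → ℤ) :=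
  (matrixD n).toCoxeterSystem.lift ⟨_, isLiftable_placePerm n⟩

theorem act_simple (n : ℕ) (j : Fin n) (f : ℕ → ℤ) :
    act n ((matrixD n).toCoxeterSystem.simple j) f = placeMap j f := by
  unfold act
  rw [CoxeterSystem.lift_apply_simple]
  rfl

theorem act_gen {n j : ℕ} (hj : j < n) (f : ℕ → ℤ) : act n (gen n j) f = placeMap j f := by
  rw [gen, dif_pos hj, ← CoxeterMatrix.toCoxeterSystem_simple, act_simple]

/-- The places in their natural order, a point of the dominant chamber. -/
def base (a : ℕ) : ℤ := a

theorem root_act_pos {n : ℕ} (g : D n) (j : Fin n)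
    (h : (matrixD n).toCoxeterSystem.length g <
      (matrixD n).toCoxeterSystem.length ((matrixD n).toCoxeterSystem.simple j * g)) :
    0 < root j (act n g base) := by
  have hM : ∀ s t : Fin n, matrixD n s t = (if s = t then 1
    else if (1 ≤ (s : ℕ) ∧ (s : ℕ) + 1 = t) ∨ (1 ≤ (t : ℕ) ∧ (t : ℕ) + 1 = s) then 3
    else if ((s : ℕ) = 0 ∧ (t : ℕ) = 2) ∨ ((t : ℕ) = 0 ∧ (s : ℕ) = 2) then 3
    else 2) := fun _ _ ↦ rfl
  refine pos_of_length_lt (matrixD n).toCoxeterSystem (act n) (fun j ↦ root j)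
    ?_ ?_ ?_ ?_ base ?_ g j h
  · intro s t hst
    rw [hM, if_neg hst]
    split_ifs <;> simp
  · intro s f
    rw [act_simple]
    simp only [root, placeMap]
    grind
  · intro s t f hst
    rw [hM] at hst
    rw [act_simple]
    simp only [root, placeMap]
    grind
  · intro s t f hst
    rw [hM] at hst
    rw [act_simple]
    simp only [root, placeMap]
    grind
  · intro s
    simp only [root, base]
    split_ifs
    · norm_num
    · have : ((s : ℕ) - 1 : ℕ) < (s : ℕ) := by omega
      omega

/-- The number of positive roots `e_b ± e_a` that a pair of entries makes negative. -/
def pairNeg (x y : ℤ) : ℕ := (if y < x then 1 else 0) + (if x + y < 0 then 1 else 0)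

/-- The pairs of places `a < b < n`. -/
def placePairs (n : ℕ) : Finset (ℕ × ℕ) :=
  (Finset.range n ×ˢ Finset.range n).filter fun p ↦ p.1 < p.2

theorem mem_placePairs {n : ℕ} {p : ℕ × ℕ} : p ∈ placePairs n ↔ p.1 < p.2 ∧ p.2 < n := by
  simp only [placePairs, Finset.mem_filter, Finset.mem_product, Finset.mem_range]
  omega

/-- The number of positive roots of `D_n` that are negative on `f`. -/
def negRoots (n : ℕ) (f : ℕ → ℤ) : ℕ := ∑ p ∈ placePairs n, pairNeg (f p.1) (f p.2)

theorem sum_erase_swap {n j : ℕ} (h : j + 1 < n) (φ : ℕ → ℕ → ℕ) :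
    ∑ p ∈ (placePairs n).erase (j, j + 1),
        φ (Equiv.swap j (j + 1) p.1) (Equiv.swap j (j + 1) p.2)
      = ∑ p ∈ (placePairs n).erase (j, j + 1), φ p.1 p.2 := by
  refine Finset.sum_nbij' (fun p ↦ (Equiv.swap j (j + 1) p.1, Equiv.swap j (j + 1) p.2))
    (fun p ↦ (Equiv.swap j (j + 1) p.1, Equiv.swap j (j + 1) p.2)) ?_ ?_ ?_ ?_ ?_
  · rintro ⟨a, b⟩
    simp only [Finset.mem_erase, mem_placePairs, Equiv.swap_apply_def, Prod.mk.injEq, ne_eq]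
    grind
  · rintro ⟨a, b⟩
    simp only [Finset.mem_erase, mem_placePairs, Equiv.swap_apply_def, Prod.mk.injEq, ne_eq]
    grind
  · simp
  · simp
  · simp

theorem negRoots_placeMap {n j : ℕ} (hn : 2 ≤ n) (hj : j < n) {f : ℕ → ℤ} (hf : 0 < root j f) :
    negRoots n (placeMap j f) = negRoots n f + 1 := by
  have hmem : (j - 1, j - 1 + 1) ∈ placePairs n := by
    rw [mem_placePairs]
    dsimp only
    omega
  unfold negRoots
  rw [← Finset.add_sum_erase _ _ hmem, ← Finset.add_sum_erase _ _ hmem]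
  have hswap := sum_erase_swap (n := n) (j := j - 1) (by omega) (fun a b ↦ pairNeg (f a) (f b))
  have hcongr : ∑ p ∈ (placePairs n).erase (j - 1, j - 1 + 1),
        pairNeg (placeMap j f p.1) (placeMap j f p.2)
      = ∑ p ∈ (placePairs n).erase (j - 1, j - 1 + 1),
        pairNeg (f (Equiv.swap (j - 1) (j - 1 + 1) p.1))
          (f (Equiv.swap (j - 1) (j - 1 + 1) p.2)) := by
    refine Finset.sum_congr rfl ?_
    rintro ⟨a, b⟩ hp
    simp only [Finset.mem_erase, mem_placePairs, Prod.mk.injEq, ne_eq] at hp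
    simp only [placeMap, pairNeg, Equiv.swap_apply_def]
    rcases Nat.eq_zero_or_pos j with rfl | hj0
    · have hb : ¬ b = 0 := by omega
      have hb' : ¬ b = 1 := by omega
      simp only [if_true, hb, hb', if_false, Nat.zero_sub, Nat.zero_add]
      split_ifs <;> omega
    · have e : j - 1 + 1 = j := by omega
      have e' : ∀ a, a + 1 = j ↔ a = j - 1 := by omega
      simp only [e, e', if_neg hj0.ne', apply_ite f]
  rw [hcongr, hswap]
  have hpair : pairNeg (placeMap j f (j - 1)) (placeMap j f (j - 1 + 1))
      = pairNeg (f (j - 1)) (f (j - 1 + 1)) + 1 := by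
    simp only [placeMap, pairNeg, root] at hf ⊢
    rcases Nat.eq_zero_or_pos j with rfl | hj0
    · simp only [if_true, Nat.zero_sub, Nat.zero_add] at hf ⊢
      simp only [one_ne_zero, if_false]
      split_ifs <;> omega
    · have e : j - 1 + 1 = j := by omega
      have e' : ¬ j + 1 = j := by omega
      simp only [e, e', if_neg hj0.ne', if_true, if_false] at hf ⊢
      split_ifs <;> omega
  dsimp only at hpair ⊢
  rw [hpair]
  ring

theorem negRoots_base (n : ℕ) : negRoots n base = 0 := by
  refine Finset.sum_eq_zero ?_
  rintro ⟨a, b⟩ hp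
  rw [mem_placePairs] at hp
  dsimp only at hp
  have h1 : ¬ base b < base a := by simp only [base]; omega
  have h2 : ¬ base a + base b < 0 := by simp only [base]; omega
  simp only [pairNeg, h1, h2, if_false, add_zero]

/-- The length in `D_n` counts the positive roots that are made negative. -/
theorem ell_eq_negRoots {n : ℕ} (hn : 2 ≤ n) (g : D n) : ell g = negRoots n (act n g base) := by
  unfold ell
  induction g using (matrixD n).toCoxeterSystem.simple_induction_left with
  | one => simp [negRoots_base]
  | mul_simple_left g j ih =>
    have hρ : ∀ (r : Fin n) (x : D n),
        act n ((matrixD n).toCoxeterSystem.simple r * x) base = placeMap r (act n x base) := by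
      intro r x
      rw [map_mul, Equiv.Perm.mul_apply, act_simple]
    rcases (matrixD n).toCoxeterSystem.length_simple_mul g j with h | h
    · rw [h, hρ, negRoots_placeMap hn j.isLt (root_act_pos g j (by omega)), ih]
    · have := root_act_pos ((matrixD n).toCoxeterSystem.simple j * g) j
        (by rw [CoxeterSystem.simple_mul_simple_cancel_left]; omega)
      have := negRoots_placeMap hn j.isLt this
      rw [← hρ, CoxeterSystem.simple_mul_simple_cancel_left] at this
      omega

theorem prime_one (n : ℕ) : prime (1 : D n) = 1 := by simp [prime]

theorem prime_simple_mul {n : ℕ} (j : Fin n) (g : D n) :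
    prime ((matrixD n).toCoxeterSystem.simple j * g) = prime g * adj n ((j : ℕ) - 1) := by
  unfold prime Phi
  rw [map_mul, CoxeterSystem.lift_apply_simple]
  rfl

theorem abs_placeMap {n : ℕ} (hn : 2 ≤ n) (j a : Fin n) (f : ℕ → ℤ) :
    |placeMap j f a| = |f (adj n ((j : ℕ) - 1) a)| := by
  have hj := j.isLt
  have h : (j : ℕ) - 1 + 1 < n := by omega
  rw [adj, dif_pos h, Equiv.swap_apply_def]
  simp only [placeMap, Fin.ext_iff]
  grind

/-- Up to sign, the action on the natural order is the permutation `prime g`. -/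
theorem abs_act_base {n : ℕ} (hn : 2 ≤ n) (g : D n) (a : Fin n) :
    |act n g base a| = (prime g a : ℕ) := by
  induction g using (matrixD n).toCoxeterSystem.simple_induction_left generalizing a with
  | one => simp [prime_one, base]
  | mul_simple_left g j ih =>
    rw [map_mul, Equiv.Perm.mul_apply, act_simple, abs_placeMap hn, ih, prime_simple_mul,
      Equiv.Perm.mul_apply]

theorem w_one (n : ℕ) : w n 1 = gen n 1 * gen n 0 := by simp [w]

theorem w_succ (n : ℕ) {k : ℕ} (hk : 1 ≤ k) :
    w n (k + 1) = gen n (k + 1) * w n k * gen n (k + 1) := by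
  obtain ⟨k, rfl⟩ : ∃ l, k = l + 1 := ⟨k - 1, by omega⟩
  unfold w
  rw [List.range_succ_eq_map (n := k + 1), List.map_cons, List.prod_cons, List.map_map]
  have h1 : ((fun j ↦ gen n (k + 1 + 1 - j)) ∘ Nat.succ) = fun j ↦ gen n (k + 1 - j) := by
    funext j
    simp only [Function.comp_apply]
    congr 1
    omega
  rw [h1, Nat.add_sub_cancel, Nat.add_sub_cancel, List.range_succ (n := k), List.map_append,
    List.prod_append]
  simp [mul_assoc]

/-- `w_k` changes the signs at the places `0` and `k`. -/
theorem act_w {n k : ℕ} (hk : 1 ≤ k) (hkn : k < n) (f : ℕ → ℤ) (a : ℕ) :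
    act n (w n k) f a = if a = 0 ∨ a = k then -f a else f a := by
  induction k, hk using Nat.le_induction generalizing f a with
  | base =>
    rw [w_one, map_mul, Equiv.Perm.mul_apply, act_gen hkn, act_gen (by omega)]
    simp only [placeMap]
    grind
  | succ k hk ih =>
    rw [w_succ n hk, map_mul, map_mul, Equiv.Perm.mul_apply, Equiv.Perm.mul_apply, act_gen hkn,
      act_gen hkn]
    have := ih (by omega) (placeMap (k + 1) f)
    rw [funext this]
    simp only [placeMap]
    grind

theorem wProd_succ (n : ℕ) {u : ℕ} (L : Fin (u + 1) → ℕ) :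
    wProd n L = w n (L 0) * wProd n (fun j ↦ L j.succ) := by
  simp [wProd, List.ofFn_succ]

theorem act_wProd_zero {n u : ℕ} {L : Fin u → ℕ} (hL : ∀ j, 1 ≤ L j ∧ L j < n) (f : ℕ → ℤ) :
    act n (wProd n L) f 0 = f 0 ∨ act n (wProd n L) f 0 = -f 0 := by
  induction u with
  | zero => simp [wProd]
  | succ u ih =>
    rw [wProd_succ, map_mul, Equiv.Perm.mul_apply, act_w (hL 0).1 (hL 0).2, if_pos (Or.inl rfl)]
    rcases ih (fun j ↦ hL j.succ) with h | h <;> rw [h] <;> simp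

theorem act_wProd {n u : ℕ} {L : Fin u → ℕ} (hL : ∀ j, 1 ≤ L j ∧ L j < n)
    (hinj : Function.Injective L) (f : ℕ → ℤ) {a : ℕ} (ha : 1 ≤ a) :
    act n (wProd n L) f a = if a ∈ Finset.univ.image L then -f a else f a := by
  induction u with
  | zero => simp [wProd]
  | succ u ih =>
    rw [wProd_succ, map_mul, Equiv.Perm.mul_apply, act_w (hL 0).1 (hL 0).2,
      ih (fun j ↦ hL j.succ) (hinj.comp (Fin.succ_injective u))]
    simp only [Finset.mem_image, Finset.mem_univ, true_and, Fin.exists_fin_succ]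
    by_cases h0 : a = L 0
    · have : ¬ ∃ j : Fin u, L j.succ = a := by
        rintro ⟨j, hj⟩
        exact (Fin.succ_ne_zero j) (hinj (hj.trans h0))
      simp [h0.symm, this]
    · have h0' : ¬ L 0 = a := fun h ↦ h0 h.symm
      have ha' : a ≠ 0 := by omega
      simp [h0, h0', ha']

theorem act_t {n m : ℕ} (hm : 1 ≤ m) (hmn : m ≤ n) (f : ℕ → ℤ) (a : ℕ) :
    act n (t n m) f a = if a = 0 then f (m - 1) else if a < m then f (a - 1) else f a := by
  induction m, hm using Nat.le_induction generalizing f a with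
  | base =>
    simp only [t, Nat.sub_self, List.range_zero, List.map_nil, List.prod_nil, map_one,
      Equiv.Perm.one_apply]
    grind
  | succ m hm ih =>
    have ht : t n (m + 1) = t n m * gen n m := by
      obtain ⟨m, rfl⟩ : ∃ l, m = l + 1 := ⟨m - 1, by omega⟩
      simp [t, List.range_succ]
    rw [ht, map_mul, Equiv.Perm.mul_apply, act_gen (by omega), ih (by omega)]
    simp only [placeMap]
    grind

theorem act_t_pow {n m i : ℕ} (hm : 1 ≤ m) (hmn : m ≤ n) (hi : i ≤ m) (f : ℕ → ℤ) (a : ℕ) :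
    act n (t n m ^ i) f a =
      if a < i then f (a + (m - i)) else if a < m then f (a - i) else f a := by
  induction i generalizing f a with
  | zero => simp
  | succ i ih =>
    rw [pow_succ, map_mul, Equiv.Perm.mul_apply, ih (by omega)]
    simp only [act_t hm hmn]
    have h1 : a < i → a + (m - i) - 1 = a + (m - (i + 1)) := by omega
    have h2 : a = i → a + (m - (i + 1)) = m - 1 := by omega
    grind

theorem tProd_succ (n : ℕ) {m : ℕ} (k i : Fin (m + 1) → ℕ) :
    tProd n k i = t n (k 0) ^ i 0 * tProd n (fun x ↦ k x.succ) (fun x ↦ i x.succ) := by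
  simp [tProd, List.ofFn_succ]

theorem IsElementary.tail {n m : ℕ} {k i : Fin (m + 1) → ℕ} (h : IsElementary n k i) :
    IsElementary n (fun x ↦ k x.succ) (fun x ↦ i x.succ) where
  strictMono := h.strictMono.comp (Fin.strictMono_succ)
  two_le x := h.two_le _
  le_n x := h.le_n _
  exp_pos x := h.exp_pos _
  exp_lt x := h.exp_lt _
  sum_le hm := by
    have h1 := h.sum_le (Nat.succ_pos m)
    rw [Fin.sum_univ_succ] at h1
    have h2 : k 0 < k (Fin.succ ⟨0, hm⟩) := h.strictMono (Fin.succ_pos _)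
    have h3 : k ⟨0, Nat.succ_pos m⟩ = k 0 := rfl
    omega

theorem act_tProd_succ {n m : ℕ} {k i : Fin (m + 1) → ℕ} (h : IsElementary n k i) (a : ℕ) :
    act n (tProd n k i) base a =
      if a < i 0 then act n (tProd n (fun x ↦ k x.succ) (fun x ↦ i x.succ)) base (a + (k 0 - i 0))
      else if a < k 0 then act n (tProd n (fun x ↦ k x.succ) (fun x ↦ i x.succ)) base (a - i 0)
      else act n (tProd n (fun x ↦ k x.succ) (fun x ↦ i x.succ)) base a := by
  have := h.two_le 0
  rw [tProd_succ, map_mul, Equiv.Perm.mul_apply, act_t_pow (by omega) (h.le_n 0) (h.exp_lt 0).le]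

theorem act_tProd_of_ge {n m : ℕ} {k i : Fin m → ℕ} (h : IsElementary n k i) {a : ℕ}
    (ha : ∑ x, i x ≤ a) :
    act n (tProd n k i) base a = (a : ℤ) - ∑ x with a < k x, (i x : ℤ) := by
  induction m generalizing a with
  | zero => simp [tProd, base]
  | succ m ih =>
    have hs := h.sum_le (Nat.succ_pos m)
    change ∑ x, i x ≤ k 0 at hs
    have hk : ∀ x : Fin m, k 0 < k x.succ := fun x ↦ h.strictMono (Fin.succ_pos x)
    rw [Fin.sum_univ_succ] at ha hs
    rw [act_tProd_succ h, if_neg (by omega), Finset.sum_filter, Fin.sum_univ_succ]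
    split_ifs with h1
    · rw [ih h.tail (by omega), Finset.sum_filter]
      have e : ∀ x : Fin m, (if a - i 0 < k x.succ then (i x.succ : ℤ) else 0)
          = if a < k x.succ then (i x.succ : ℤ) else 0 := by
        intro x
        have := hk x
        rw [if_pos (by omega), if_pos (by omega)]
      rw [Finset.sum_congr rfl fun x _ ↦ e x]
      omega
    · rw [ih h.tail (by omega), Finset.sum_filter, zero_add]

theorem le_act_tProd_of_lt {n m : ℕ} {k i : Fin (m + 1) → ℕ} (h : IsElementary n k i) {a : ℕ}
    (ha : a < ∑ x, i x) :
    (k 0 : ℤ) - ∑ x, (i x : ℤ) + a ≤ act n (tProd n k i) base a := by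
  induction m generalizing a with
  | zero =>
    have := h.exp_lt 0
    simp only [Fin.sum_univ_succ, Fin.sum_univ_zero, add_zero] at ha ⊢
    rw [act_tProd_succ h, if_pos ha]
    simp only [tProd, List.ofFn_zero, List.prod_nil, map_one, Equiv.Perm.one_apply, base]
    omega
  | succ m ih =>
    have hs := h.sum_le (Nat.succ_pos _)
    change ∑ x, i x ≤ k 0 at hs
    have hk : ∀ x : Fin (m + 1), k 0 < k x.succ := fun x ↦ h.strictMono (Fin.succ_pos x)
    have hi := h.exp_lt 0
    rw [Fin.sum_univ_succ] at ha hs ⊢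
    rw [act_tProd_succ h]
    split_ifs with h1 h2
    · rw [act_tProd_of_ge h.tail (by omega), Finset.filter_true_of_mem]
      · omega
      · intro x _
        have := hk x
        omega
    · have := ih h.tail (a := a - i 0) (by omega)
      have := hk 0
      omega
    · omega

theorem act_tProd_strictMono_of_lt {n m : ℕ} {k i : Fin m → ℕ} (h : IsElementary n k i) {a b : ℕ}
    (hab : a < b) (hb : b < ∑ x, i x) :
    act n (tProd n k i) base a < act n (tProd n k i) base b := by
  induction m generalizing a b with
  | zero => simp at hb
  | succ m ih =>
    have hs := h.sum_le (Nat.succ_pos _)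
    change ∑ x, i x ≤ k 0 at hs
    have hk : ∀ x : Fin m, k 0 < k x.succ := fun x ↦ h.strictMono (Fin.succ_pos x)
    have hi := h.exp_lt 0
    rw [Fin.sum_univ_succ] at hb hs
    have hF : ∀ c, c < i 0 →
        act n (tProd n (fun x ↦ k x.succ) (fun x ↦ i x.succ)) base (c + (k 0 - i 0))
          = (c : ℤ) + (k 0 - i 0) - ∑ x : Fin m, (i x.succ : ℤ) := by
      intro c hc
      rw [act_tProd_of_ge h.tail (by omega), Finset.filter_true_of_mem]
      · omega
      · intro x _
        have := hk x
        omega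
    rw [act_tProd_succ h, act_tProd_succ h]
    by_cases h1 : b < i 0
    · rw [if_pos (by omega), if_pos h1, hF _ (by omega), hF _ h1]
      omega
    · rw [if_neg h1, if_pos (c := b < k 0) (by omega)]
      split_ifs with h2 h3
      · rw [hF _ h2]
        obtain ⟨m, rfl⟩ : ∃ l, m = l + 1 := by
          rcases m with _ | m
          · simp at hb
            omega
          · exact ⟨m, rfl⟩
        have := le_act_tProd_of_lt h.tail (a := b - i 0) (by omega)
        have := hk 0
        omega
      · exact ih h.tail (by omega) (by omega)
      · omega

theorem act_tProd_strictMono_of_ge {n m : ℕ} {k i : Fin m → ℕ} (h : IsElementary n k i) {a b : ℕ}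
    (hab : a < b) (ha : ∑ x, i x ≤ a) :
    act n (tProd n k i) base a < act n (tProd n k i) base b := by
  rw [act_tProd_of_ge h ha, act_tProd_of_ge h (by omega)]
  have : ∑ x with b < k x, (i x : ℤ) ≤ ∑ x with a < k x, (i x : ℤ) :=
    Finset.sum_le_sum_of_subset_of_nonneg
      (Finset.monotone_filter_right _ fun x _ hx ↦ hab.trans hx) fun _ _ _ ↦ by positivity
  omega

theorem act_tProd_nonneg {n m : ℕ} {k i : Fin m → ℕ} (h : IsElementary n k i) (a : ℕ) :
    0 ≤ act n (tProd n k i) base a := by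
  by_cases ha : ∑ x, i x ≤ a
  · rw [act_tProd_of_ge h ha]
    have : ∑ x with a < k x, (i x : ℤ) ≤ ∑ x, (i x : ℤ) :=
      Finset.sum_le_sum_of_subset_of_nonneg (Finset.filter_subset _ _)
        fun _ _ _ ↦ by positivity
    zify at ha
    omega
  · rcases m with _ | m
    · simp at ha
    · have h1 := le_act_tProd_of_lt h (not_le.1 ha)
      have hs := h.sum_le (Nat.succ_pos _)
      change ∑ x, i x ≤ k 0 at hs
      zify at hs
      omega

/-- The permutation of an elementary form, written out. -/
theorem coe_prime_tProd {n m : ℕ} (hn : 2 ≤ n) {k i : Fin m → ℕ} (h : IsElementary n k i)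
    (a : Fin n) : ((prime (tProd n k i) a : ℕ) : ℤ) = act n (tProd n k i) base a := by
  rw [← abs_act_base hn, abs_of_nonneg (act_tProd_nonneg h _)]

theorem act_tProd_ne {n m : ℕ} (hn : 2 ≤ n) {k i : Fin m → ℕ} (h : IsElementary n k i) {a b : ℕ}
    (hab : a < b) (hb : b < n) :
    act n (tProd n k i) base a ≠ act n (tProd n k i) base b := by
  have ha := coe_prime_tProd hn h ⟨a, hab.trans hb⟩
  have hb := coe_prime_tProd hn h ⟨b, hb⟩
  dsimp only at ha hb
  rw [← ha, ← hb]
  intro he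
  have := (prime (tProd n k i)).injective (Fin.ext (Int.ofNat_inj.1 he))
  rw [Fin.mk.injEq] at this
  omega

theorem maj_prime_tProd {n m : ℕ} (hn : 2 ≤ n) {k i : Fin m → ℕ} (h : IsElementary n k i) :
    maj (prime (tProd n k i)) = ∑ x, i x := by
  set S := ∑ x, i x with hS
  have hlt : ∀ (a b : Fin n), prime (tProd n k i) a < prime (tProd n k i) b ↔
      act n (tProd n k i) base a < act n (tProd n k i) base b := by
    intro a b
    rw [Fin.lt_def, ← coe_prime_tProd hn h, ← coe_prime_tProd hn h, Nat.cast_lt]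
  have hasc : ∀ a : Fin n, (a : ℕ) + 1 ≠ S → (if ha : (a : ℕ) + 1 < n then
      (if prime (tProd n k i) ⟨(a : ℕ) + 1, ha⟩ < prime (tProd n k i) a
        then (a : ℕ) + 1 else 0) else 0) = 0 := by
    intro a haS
    split_ifs with h1 h2
    · rw [hlt] at h2
      dsimp only at h2
      rcases lt_or_gt_of_ne haS with h3 | h3
      · have := act_tProd_strictMono_of_lt h (Nat.lt_add_one (a : ℕ)) h3
        omega
      · have := act_tProd_strictMono_of_ge h (Nat.lt_add_one (a : ℕ)) (by omega)
        omega
    · rfl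
    · rfl
  unfold maj
  rcases Nat.eq_zero_or_pos S with h0 | h0
  · rw [h0]
    exact Finset.sum_eq_zero fun a _ ↦ hasc a (by omega)
  rcases m with _ | m
  · simp at hS
    omega
  have hs := h.sum_le (Nat.succ_pos _)
  change ∑ x, i x ≤ k 0 at hs
  have hSk : (S : ℤ) = ∑ x, (i x : ℤ) := by rw [hS, Nat.cast_sum]
  have hSn : S < n := by
    rcases m with _ | m
    · have h1 := h.exp_lt 0
      have h2 := h.le_n 0
      rw [Fin.sum_univ_succ, Fin.sum_univ_zero, add_zero] at hS
      omega
    · have h1 : k 0 < k 1 := h.strictMono (by simp)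
      have h2 := h.le_n 1
      omega
  rw [Finset.sum_eq_single ⟨S - 1, by omega⟩]
  · have e : S - 1 + 1 = S := by omega
    simp only [e]
    rw [dif_pos hSn, if_pos]
    rw [hlt]
    dsimp only
    have hne := act_tProd_ne hn h (a := S - 1) (b := S) (by omega) hSn
    have hle := le_act_tProd_of_lt h (a := S - 1) (by omega)
    have hge := act_tProd_of_ge h hS.symm.le
    have hpos : 0 < ∑ x with S < k x, (i x : ℤ) ∨ (k 0 = S ∧ m = 0) := by
      by_cases hk0 : S < k 0
      · left
        refine Finset.sum_pos (fun x _ ↦ by exact_mod_cast h.exp_pos x) ⟨0, by simpa using hk0⟩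
      · rcases m with _ | m
        · right
          exact ⟨by omega, rfl⟩
        · left
          refine Finset.sum_pos (fun x _ ↦ by exact_mod_cast h.exp_pos x) ⟨1, ?_⟩
          have : k 0 < k 1 := h.strictMono (by simp)
          simp
          omega
    rcases hpos with hpos | ⟨hk0, rfl⟩
    · omega
    · have h1 := h.exp_lt 0
      rw [Fin.sum_univ_succ, Fin.sum_univ_zero, add_zero] at hS
      omega
  · intro a _ ha
    refine hasc a fun h1 ↦ ha (Fin.ext ?_)
    dsimp only
    omega
  · simp

theorem inv_prime_tProd {n m : ℕ} (hn : 2 ≤ n) {k i : Fin m → ℕ} (h : IsElementary n k i) :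
    inv (prime (tProd n k i)) = ∑ p ∈ placePairs n,
      if act n (tProd n k i) base p.2 < act n (tProd n k i) base p.1 then 1 else 0 := by
  rw [← Finset.card_filter]
  refine Finset.card_bij (fun p _ ↦ ((p.1 : ℕ), (p.2 : ℕ))) ?_ ?_ ?_
  · rintro ⟨a, b⟩ hp
    simp only [Finset.mem_filter, Finset.mem_univ, true_and, Fin.lt_def] at hp
    rw [Finset.mem_filter, mem_placePairs, ← coe_prime_tProd hn h, ← coe_prime_tProd hn h]
    exact ⟨⟨hp.1, b.isLt⟩, by exact_mod_cast hp.2⟩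
  · rintro ⟨a, b⟩ _ ⟨c, d⟩ _ he
    simpa [Fin.ext_iff] using he
  · rintro ⟨a, b⟩ hp
    rw [Finset.mem_filter, mem_placePairs] at hp
    dsimp only at hp
    refine ⟨(⟨a, by omega⟩, ⟨b, by omega⟩), ?_, rfl⟩
    simp only [Finset.mem_filter, Finset.mem_univ, true_and, Fin.lt_def]
    refine ⟨hp.1.1, ?_⟩
    have := hp.2
    have ha := coe_prime_tProd hn h ⟨a, by omega⟩
    have hb := coe_prime_tProd hn h ⟨b, by omega⟩
    dsimp only at ha hb
    rw [← ha, ← hb] at this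
    exact_mod_cast this

theorem sum_placePairs (n : ℕ) (φ : ℕ → ℕ → ℕ) :
    ∑ p ∈ placePairs n, φ p.1 p.2 = ∑ b ∈ Finset.range n, ∑ a ∈ Finset.range b, φ a b := by
  rw [placePairs, Finset.sum_filter, Finset.sum_product_right]
  refine Finset.sum_congr rfl fun b hb ↦ ?_
  rw [← Finset.sum_filter]
  refine Finset.sum_congr ?_ fun _ _ ↦ rfl
  ext a
  simp only [Finset.mem_filter, Finset.mem_range] at hb ⊢
  omega

/-- Changing the sign at the place `b ≥ 1` of a sequence of distinct natural numbers adds twice the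
number of smaller entries at earlier places to the number of negative roots. -/
theorem negRoots_signs {n : ℕ} {F G : ℕ → ℤ} {I : Finset ℕ} (hI : ∀ b ∈ I, b < n)
    (hF : ∀ a, 0 ≤ F a) (hne : ∀ a b, a < b → b < n → F a ≠ F b)
    (h0 : G 0 = F 0 ∨ G 0 = -F 0) (hG : ∀ a, 1 ≤ a → G a = if a ∈ I then -F a else F a) :
    negRoots n G = (∑ p ∈ placePairs n, if F p.2 < F p.1 then 1 else 0)
      + 2 * ∑ b ∈ I, ((Finset.range b).filter fun a ↦ F a < F b).card := by
  have hpair : ∀ p ∈ placePairs n, pairNeg (G p.1) (G p.2)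
      = (if F p.2 < F p.1 then 1 else 0)
        + if p.2 ∈ I then 2 * (if F p.1 < F p.2 then 1 else 0) else 0 := by
    rintro ⟨a, b⟩ hp
    rw [mem_placePairs] at hp
    dsimp only at hp ⊢
    have hGa : G a = F a ∨ G a = -F a := by
      rcases Nat.eq_zero_or_pos a with rfl | ha
      · exact h0
      · rw [hG a ha]
        split_ifs <;> simp
    have hab := hne a b hp.1 hp.2
    have ha := hF a
    have hb := hF b
    rw [hG b (by omega)]
    unfold pairNeg
    by_cases hbI : b ∈ I
    · simp only [if_pos hbI]
      rcases hGa with h | h <;> rw [h] <;> split_ifs <;> omega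
    · simp only [if_neg hbI]
      rcases hGa with h | h <;> rw [h] <;> split_ifs <;> omega
  rw [negRoots, Finset.sum_congr rfl hpair, Finset.sum_add_distrib,
    sum_placePairs n fun a b ↦ if b ∈ I then 2 * (if F a < F b then 1 else 0) else 0,
    Finset.mul_sum]
  congr 1
  have hsub : I ⊆ Finset.range n := fun b hb ↦ Finset.mem_range.2 (hI b hb)
  rw [← Finset.sum_subset hsub]
  · refine Finset.sum_congr rfl fun b hb ↦ ?_
    rw [Finset.card_filter, Finset.mul_sum]
    simp only [if_pos hb]
  · intro b _ hb
    simp only [if_neg hb, Finset.sum_const_zero]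

/-- `ϱ_L` is the number of entries before the place `L` that are smaller than the entry there. -/
theorem card_smaller_before {n m : ℕ} (hn : 2 ≤ n) {k i : Fin m → ℕ} (h : IsElementary n k i)
    {l : ℕ} (hl : l < n) :
    (((Finset.range l).filter fun a ↦
        act n (tProd n k i) base a < act n (tProd n k i) base l).card : ℤ)
      = varrho k i (∑ x, i x) l := by
  unfold varrho
  by_cases hlS : l < ∑ x, i x
  · rw [if_pos (Or.inl hlS), Finset.filter_true_of_mem, Finset.card_range]
    exact fun a ha ↦ act_tProd_strictMono_of_lt h (Finset.mem_range.1 ha) hlS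
  · have hcard : ((Finset.range l).filter fun a ↦
        act n (tProd n k i) base a < act n (tProd n k i) base l).card
        = (prime (tProd n k i) ⟨l, hl⟩ : ℕ) := by
      rw [← Fin.card_Iio (prime (tProd n k i) ⟨l, hl⟩)]
      symm
      refine Finset.card_bij (fun y _ ↦ (((prime (tProd n k i)).symm y : Fin n) : ℕ)) ?_ ?_ ?_
      · intro y hy
        have hlt : act n (tProd n k i) base ((prime (tProd n k i)).symm y : Fin n)
            < act n (tProd n k i) base l := by
          have hb := coe_prime_tProd hn h ⟨l, hl⟩
          dsimp only at hb
          rw [← coe_prime_tProd hn h, ← hb, Equiv.apply_symm_apply]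
          exact_mod_cast Finset.mem_Iio.1 hy
        refine Finset.mem_filter.2 ⟨Finset.mem_range.2 ?_, hlt⟩
        by_contra hc
        rcases (not_lt.1 hc).eq_or_lt with he | he
        · rw [← he] at hlt
          exact hlt.false
        · exact (act_tProd_strictMono_of_ge h he (not_lt.1 hlS)).not_gt hlt
      · intro y _ z _ he
        exact (prime (tProd n k i)).symm.injective (Fin.ext he)
      · intro a ha
        rw [Finset.mem_filter, Finset.mem_range] at ha
        refine ⟨prime (tProd n k i) ⟨a, by omega⟩, ?_, by simp⟩
        have h1 := coe_prime_tProd hn h ⟨a, by omega⟩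
        have h2 := coe_prime_tProd hn h ⟨l, hl⟩
        have h3 := ha.2
        dsimp only at h1 h2
        rw [← h1, ← h2] at h3
        exact Finset.mem_Iio.2 (by exact_mod_cast h3)
    rw [hcard, coe_prime_tProd hn h, act_tProd_of_ge h (not_lt.1 hlS)]
    split_ifs with h1 h2
    · rw [Finset.filter_false_of_mem fun x _ ↦ not_lt.2 (h1.resolve_left hlS x)]
      simp
    · rw [Finset.filter_true_of_mem fun x _ ↦ h2 x, Nat.cast_sum]
    · rfl

theorem prime_wProd_mul_tProd {n m u : ℕ} (hn : 2 ≤ n) {k i : Fin m → ℕ} {L : Fin u → ℕ}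
    (hL : ∀ j, 1 ≤ L j ∧ L j < n) (hinj : Function.Injective L) :
    prime (wProd n L * tProd n k i) = prime (tProd n k i) := by
  ext a
  have h1 := abs_act_base hn (wProd n L * tProd n k i) a
  have h2 := abs_act_base hn (tProd n k i) a
  have h3 : |act n (wProd n L * tProd n k i) base a| = |act n (tProd n k i) base a| := by
    rw [map_mul, Equiv.Perm.mul_apply]
    rcases Nat.eq_zero_or_pos (a : ℕ) with ha | ha
    · rw [ha]
      rcases act_wProd_zero hL (act n (tProd n k i) base) with h | h <;> rw [h]
      rw [abs_neg]
    · rw [act_wProd hL hinj _ ha]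
      split_ifs
      · rw [abs_neg]
      · rfl
  rw [h1, h2] at h3
  exact_mod_cast h3

end DOGS

theorem mainTheorem4 (n m u : ℕ) (k i : Fin m → ℕ) (L : Fin u → ℕ)
    (helem : DOGS.IsElementary n k i)
    (hL : ∀ j, 1 ≤ L j ∧ L j ≤ n - 1) (hinj : Function.Injective L)
    (π : DOGS.D n) (hπ : π = DOGS.wProd n L * DOGS.tProd n k i) :
    (DOGS.ell π : ℤ) = (DOGS.inv (DOGS.prime π) : ℤ)
      + 2 * ∑ j, DOGS.varrho k i (DOGS.maj (DOGS.prime π)) (L j) := by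
  open DOGS in
  subst hπ
  rcases Nat.lt_or_ge n 2 with hn | hn
  · obtain rfl : u = 0 := by
      rcases u with _ | u
      · rfl
      · have := hL 0
        omega
    obtain rfl : m = 0 := by
      rcases m with _ | m
      · rfl
      · have := helem.two_le 0
        have := helem.le_n 0
        omega
    have h1 : wProd n L * tProd n k i = 1 := by simp [wProd, tProd]
    have h2 : inv (1 : Equiv.Perm (Fin n)) = 0 := by
      unfold inv
      rw [Finset.card_eq_zero]
      exact Finset.filter_false_of_mem fun p _ hp ↦ hp.1.not_gt hp.2
    rw [h1, prime_one, h2, ell, CoxeterSystem.length_one]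
    simp
  · have hL' : ∀ j, 1 ≤ L j ∧ L j < n := fun j ↦ ⟨(hL j).1, by have := (hL j).2; omega⟩
    rw [prime_wProd_mul_tProd hn hL' hinj, maj_prime_tProd hn helem, inv_prime_tProd hn helem,
      ell_eq_negRoots hn, map_mul, Equiv.Perm.mul_apply,
      negRoots_signs (F := act n (tProd n k i) base) (I := Finset.univ.image L) ?_
        (act_tProd_nonneg helem) (fun a b hab hb ↦ act_tProd_ne hn helem hab hb)
        (act_wProd_zero hL' _) (fun a ha ↦ act_wProd hL' hinj _ ha),
      Finset.sum_image fun _ _ _ _ h ↦ hinj h]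
    · push_cast
      congr 2
      exact Finset.sum_congr rfl fun j _ ↦ card_smaller_before hn helem (hL' j).2
    · intro b hb
      obtain ⟨j, -, rfl⟩ := Finset.mem_image.1 hb
      exact (hL' j).2
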